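/- **Setting.** Let $q,s\in\mathbb R$ satisfy either $q\ge 1$ and $qs\ge 1$, or $0<q<1$ and $0<qs<1$; put $\epsilon_{q,s}=1$ in the first case and $\epsilon_{q,s}=-1$ in the second. Let $\mathcal H_A=\mathbb C^{a}$ and $\mathcal H_B=\mathbb C^{b}$. For a unit vector $|\psi\rangle\in\mathcal H_A\otimes\mathcal H_B$ with reduced state $\rho_A=\operatorname{tr}_B|\psi\rangle\langle\psi|$ put $$C_{q,s}(|\psi\rangle)=\epsilon_{q,s}\bigl(1-(\operatorname{tr}\rho_A^{\,q})^{s}\bigr),$$ and for a density matrix $\rho$ on $\mathcal H_A\otimes\mathcal H_B$ put $$C_{q,s}(\rho)=\inf\sum_i p_i\,C_{q,s}(|\psi_i\rangle),$$ where the infimum is over all finite pure-state decompositions $\rho=\sum_i p_i|\psi_i\rangle\langle\psi_i|$ with $p_i\ge 0$, $\sum_i p_i=1$ and unit vectors $|\psi_i\rangle$. A state is separable if it is a finite convex combination of product states $\sigma\otimes\tau$ of density matrices. An LOCC protocol is a finite-round protocol in which, in each round, one party applies a local quantum instrument (a finite family of completely positive maps on that party's system whose sum is trace preserving; the local output dimension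 may change and may depend on the outcome) and announces the outcome, on which all later operations may depend; outcomes may also be merged. It results in a finite family $(M_i)_i$ of completely positive maps, indexed by the final outcomes, from operators on $\mathcal H_A\otimes\mathcal H_B$ to operators on $\mathbb C^{a'}\otimes\mathbb C^{b'}$, whose sum is trace preserving. **Theorem.** The unified $(q,s)$-concurrence $C_{q,s}$ is a well-defined measure of bipartite entanglement. That is, for every density matrix $\rho$ the set over which the infimum is taken is nonempty and bounded below, and the following hold. * **(E1)** $C_{q,s}(\rho)\ge 0$ for every density matrix $\rho$. If $\rho$ is separable, then $C_{q,s}(\rho)=0$. If $q\neq 1$ and $C_{q,s}(\rho)=0$, then $\rho$ is separable. * **(E2)** For every density matrix $\rho$ and every LOCC protocol with resulting maps $(M_i)_i$, $$\sum_{i:\,p_i>0} p_i\,C_{q,s}(\rho_i)\le C_{q,s}(\rho),\qquad p_i=\operatorname{tr}M_i(\rho),\quad \rho_i=M_i(\rho)/p_i .$$ * **(E3)** $C_{q,s}\bigl(\sum_i p_i\rho_i\bigr)\le\sum_i p_i\,C_{q,s}(\rho_i)$ for every finite probability distribution $(p_i)$ and density matrices $\rho_i$ on $\mathcal H_A\otimes\mathcal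 H_B$. -/

import Mathlib

open scoped Kronecker ComplexOrder

noncomputable section

namespace QSConcurrence

/-- Operators on the bipartite Hilbert space `ℂ^a ⊗ ℂ^b`, as matrices in the product basis. -/
abbrev BiMatrix (a b : ℕ) : Type := Matrix (Fin a × Fin b) (Fin a × Fin b) ℂ

/-- Density matrices: positive semidefinite with trace one. -/
def IsDensity {n : Type*} [Fintype n] (ρ : Matrix n n ℂ) : Prop :=
  ρ.PosSemidef ∧ ρ.trace = 1

/-- Unit vectors. -/
def IsUnitVec {n : Type*} [Fintype n] (ψ : n → ℂ) : Prop :=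
  star ψ ⬝ᵥ ψ = 1

/-- The rank-one operator `|ψ⟩⟨ψ|`. -/
def ketbra {n : Type*} (ψ : n → ℂ) : Matrix n n ℂ :=
  Matrix.vecMulVec ψ (star ψ)

/-- Finite probability distributions. -/
def IsProb {ι : Type*} [Fintype ι] (p : ι → ℝ) : Prop :=
  (∀ i, 0 ≤ p i) ∧ ∑ i, p i = 1

/-- The reduced operator `tr_B ρ` on the first subsystem. -/
def reduceA {a b : ℕ} (ρ : BiMatrix a b) : Matrix (Fin a) (Fin a) ℂ :=
  Matrix.of fun i j => ∑ k, ρ (i, k) (j, k)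

/-- `tr ρ ^ q` for a real exponent `q`, where `ρ ^ q` is given by the functional calculus of the
Hermitian matrix `ρ`. -/
def trPow {n : Type*} [Fintype n] [DecidableEq n] (q : ℝ) (ρ : Matrix n n ℂ) : ℝ :=
  (cfc (fun x : ℝ => x ^ q) ρ).trace.re

/-- The first parameter regime. -/
def RegimeOne (q s : ℝ) : Prop := 1 ≤ q ∧ 1 ≤ q * s

/-- The second parameter regime. -/
def RegimeTwo (q s : ℝ) : Prop := (0 < q ∧ q < 1) ∧ (0 < q * s ∧ q * s < 1)

open Classical in
/-- The sign factor; the value `0` outside of the two regimes is a convention. -/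
def signFactor (q s : ℝ) : ℝ :=
  if RegimeOne q s then 1 else if RegimeTwo q s then -1 else 0

/-- The unified `(q, s)`-concurrence of the pure state `ψ`. -/
def pureConcurrence {a b : ℕ} (q s : ℝ) (ψ : Fin a × Fin b → ℂ) : ℝ :=
  signFactor q s * (1 - trPow q (reduceA (ketbra ψ)) ^ s)

/-- The finite ensembles of pure states that average to `ρ`. -/
def IsPureDecomposition {a b n : ℕ} (ρ : BiMatrix a b) (p : Fin n → ℝ)
    (ψ : Fin n → Fin a × Fin b → ℂ) : Prop :=
  IsProb p ∧ (∀ i, IsUnitVec (ψ i)) ∧ ρ = ∑ i, (p i : ℂ) • ketbra (ψ i)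

/-- The average pure-state concurrences of all pure-state decompositions of `ρ`. -/
def roofValues {a b : ℕ} (q s : ℝ) (ρ : BiMatrix a b) : Set ℝ :=
  {c | ∃ (n : ℕ) (p : Fin n → ℝ) (ψ : Fin n → Fin a × Fin b → ℂ),
    IsPureDecomposition ρ p ψ ∧ c = ∑ i, p i * pureConcurrence q s (ψ i)}

/-- The unified `(q, s)`-concurrence: the convex roof of the pure-state quantity. -/
def concurrence {a b : ℕ} (q s : ℝ) (ρ : BiMatrix a b) : ℝ :=
  sInf (roofValues q s ρ)

/-- Separable states: finite convex combinations of product states. -/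
def IsSeparable {a b : ℕ} (ρ : BiMatrix a b) : Prop :=
  ∃ (n : ℕ) (p : Fin n → ℝ) (σ : Fin n → Matrix (Fin a) (Fin a) ℂ)
    (τ : Fin n → Matrix (Fin b) (Fin b) ℂ),
    IsProb p ∧ (∀ i, IsDensity (σ i)) ∧ (∀ i, IsDensity (τ i)) ∧
      ρ = ∑ i, (p i : ℂ) • (σ i ⊗ₖ τ i)

/-- The completely positive map `X ↦ ∑ l, K l * X * (K l)ᴴ` with Kraus operators `K`. -/
def krausMap {m n : Type*} [Fintype n] {r : ℕ} (K : Fin r → Matrix m n ℂ) :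
    Matrix n n ℂ →ₗ[ℂ] Matrix m m ℂ where
  toFun X := ∑ l, K l * X * (K l).conjTranspose
  map_add' X Y := by simp [Matrix.mul_add, Matrix.add_mul, Finset.sum_add_distrib]
  map_smul' c X := by simp [Finset.smul_sum]

/-- The completely positive map with Kraus operators `K`, applied to the first subsystem. -/
def onA {a c : ℕ} (b : ℕ) {r : ℕ} (K : Fin r → Matrix (Fin c) (Fin a) ℂ) :
    BiMatrix a b →ₗ[ℂ] BiMatrix c b :=
  krausMap fun l => K l ⊗ₖ (1 : Matrix (Fin b) (Fin b) ℂ)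

/-- The completely positive map with Kraus operators `K`, applied to the second subsystem. -/
def onB (a : ℕ) {b c : ℕ} {r : ℕ} (K : Fin r → Matrix (Fin c) (Fin b) ℂ) :
    BiMatrix a b →ₗ[ℂ] BiMatrix a c :=
  krausMap fun l => (1 : Matrix (Fin a) (Fin a) ℂ) ⊗ₖ K l

/-- `K i l` (`i` an outcome, `l` a Kraus index) describes a quantum instrument: its outcomes are
completely positive maps whose sum is trace preserving. The output dimension may depend on the
outcome. -/
def IsInstrument {a m : ℕ} {c r : Fin m → ℕ}
    (K : (i : Fin m) → Fin (r i) → Matrix (Fin (c i)) (Fin a) ℂ) : Prop :=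
  ∑ i, ∑ l, (K i l).conjTranspose * K i l = 1

/-- `IsLOCC M`: the family of maps `M i`, indexed by the outcomes `i : ι`, is the quantum
instrument implemented by an LOCC protocol with finitely many rounds.
* `done`: the parties do nothing.
* `alice`, `bob`: a party applies a local instrument and announces the outcome `i`, and both
  parties go on with an LOCC protocol `M i` that may depend on `i`.
* `coarse`: outcomes are merged, that is, classical information is discarded.
The local dimensions may change during the protocol (local ancillas). -/
inductive IsLOCC {a' b' : ℕ} :
    {a b : ℕ} → {ι : Type} → (ι → BiMatrix a b →ₗ[ℂ] BiMatrix a' b') → Prop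
  | done : IsLOCC (fun _ : Unit => (LinearMap.id : BiMatrix a' b' →ₗ[ℂ] BiMatrix a' b'))
  | alice {a b m : ℕ} {c r : Fin m → ℕ}
      (K : (i : Fin m) → Fin (r i) → Matrix (Fin (c i)) (Fin a) ℂ) (hK : IsInstrument K)
      {κ : Fin m → Type} [∀ i, Fintype (κ i)]
      (M : (i : Fin m) → κ i → BiMatrix (c i) b →ₗ[ℂ] BiMatrix a' b')
      (hM : ∀ i, IsLOCC (M i)) :
      IsLOCC (fun x : (i : Fin m) × κ i => M x.1 x.2 ∘ₗ onA b (K x.1))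
  | bob {a b m : ℕ} {c r : Fin m → ℕ}
      (K : (i : Fin m) → Fin (r i) → Matrix (Fin (c i)) (Fin b) ℂ) (hK : IsInstrument K)
      {κ : Fin m → Type} [∀ i, Fintype (κ i)]
      (M : (i : Fin m) → κ i → BiMatrix a (c i) →ₗ[ℂ] BiMatrix a' b')
      (hM : ∀ i, IsLOCC (M i)) :
      IsLOCC (fun x : (i : Fin m) × κ i => M x.1 x.2 ∘ₗ onB a (K x.1))
  | coarse {a b : ℕ} {ι ι' : Type} [Fintype ι] [DecidableEq ι']
      (M : ι → BiMatrix a b →ₗ[ℂ] BiMatrix a' b') (hM : IsLOCC M) (f : ι → ι') :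
      IsLOCC (fun k : ι' => ∑ i with f i = k, M i)

end QSConcurrence

end

/-! Write a bipartite vector as a coefficient matrix `V`, so that its reduced operator is `V * Vᴴ`,
and extend the pure-state quantity homogeneously to positive semidefinite `R` with trace `t`:
`localEntropy` is `ε (t - t (‖R‖_q / t) ^ (q s))`. Everything except faithfulness rests on its
superadditivity (`localEntropy_add_ge`). For `q ≥ 1` this is Minkowski for the Schatten norm plus
convexity of `x ^ (q s)`; for `q < 1` both inequalities reverse, and so does the sign `ε`.

The convex roof may then be taken over unnormalised vectors (`roof`), where it is subadditive and
homogeneous. This gives convexity and handles merging of outcomes. A measurement by Bob splits `V *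
Vᴴ` into summands, so superadditivity gives monotonicity; Alice's case follows because `V * Vᴴ` and
`Vᴴ * V` have the same nonzero spectrum. Induction on the protocol gives (E2).

Separable states decompose into product vectors, whose entropy vanishes. Conversely, the infimum is
attained, because the convex hull of the compact graph of the pure-state concurrence is closed. If
it is zero, every pure state used has `tr ρ_A ^ q = 1`, which for `q ≠ 1` forces `ρ_A` to have rank
one. -/

noncomputable section

namespace QSConcurrence

open Matrix Finset

/-! ### Trace powers and the (reverse) Minkowski inequality for Schatten norms. -/

section TracePower

variable {m n : Type*} [Fintype m] [DecidableEq m] [Fintype n] [DecidableEq n]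

lemma trPow_eq_sum_eigenvalues (q : ℝ) {A : Matrix n n ℂ} (hA : A.IsHermitian) :
    trPow q A = ∑ i, hA.eigenvalues i ^ q := by
  rw [trPow, hA.cfc_eq, IsHermitian.cfc, Unitary.conjStarAlgAut_apply, trace_mul_cycle,
    Unitary.coe_star_mul_self, one_mul]
  simp [Matrix.trace]

lemma trPow_eq_sum_roots (q : ℝ) {A : Matrix n n ℂ} (hA : A.IsHermitian) :
    trPow q A = (A.charpoly.roots.map fun z => z.re ^ q).sum := by
  rw [trPow_eq_sum_eigenvalues q hA, hA.roots_charpoly_eq_eigenvalues, Multiset.map_map]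
  rfl

/-- The characteristic polynomials of `A * B` and `B * A` agree up to powers of `X`. The extra zero
roots contribute `0 ^ q = 0`, which needs `q ≠ 0`. -/
lemma trPow_mul_comm {q : ℝ} (hq : q ≠ 0) (A : Matrix m n ℂ) (B : Matrix n m ℂ)
    (h₁ : (A * B).IsHermitian) (h₂ : (B * A).IsHermitian) :
    trPow q (A * B) = trPow q (B * A) := by
  rw [trPow_eq_sum_roots q h₁, trPow_eq_sum_roots q h₂]
  have key := congrArg (fun P : Polynomial ℂ => (P.roots.map fun z : ℂ => z.re ^ q).sum)
    (charpoly_mul_comm' A B)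
  have hroots : ∀ (k : ℕ) (P : Polynomial ℂ), P.Monic →
      ((Polynomial.X ^ k * P).roots.map fun z : ℂ => z.re ^ q).sum =
        (P.roots.map fun z : ℂ => z.re ^ q).sum := by
    intro k P hP
    rw [Polynomial.roots_mul (((Polynomial.monic_X_pow k).mul hP).ne_zero)]
    simp [Multiset.map_nsmul, Multiset.sum_nsmul, Real.zero_rpow hq]
  simpa only [hroots _ _ (charpoly_monic _)] using key

lemma trPow_transpose (q : ℝ) {A : Matrix n n ℂ} (hA : A.IsHermitian) :
    trPow q Aᵀ = trPow q A := by
  rw [trPow_eq_sum_roots q hA, trPow_eq_sum_roots q hA.transpose, charpoly_transpose]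

lemma trPow_smul {q c : ℝ} (hc : 0 ≤ c) {A : Matrix n n ℂ} (hA : A.PosSemidef) :
    trPow q ((c : ℂ) • A) = c ^ q * trPow q A := by
  have h : cfc (fun x : ℝ => x ^ q) (c • A) = cfc (fun x : ℝ => (c • x) ^ q) A :=
    (cfc_comp_smul c (fun x : ℝ => x ^ q) A
      ((A.finite_real_spectrum.image _).continuousOn _) hA.isHermitian).symm
  have h' : (c : ℂ) • A = c • A := by ext; simp
  rw [trPow, h', h, trPow_eq_sum_eigenvalues q hA.1, hA.1.cfc_eq, IsHermitian.cfc,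
    Unitary.conjStarAlgAut_apply, trace_mul_cycle, Unitary.coe_star_mul_self, one_mul,
    Finset.mul_sum]
  simp [Matrix.trace, Real.mul_rpow hc (hA.eigenvalues_nonneg _)]

lemma trPow_nonneg (q : ℝ) {A : Matrix n n ℂ} (hA : A.PosSemidef) : 0 ≤ trPow q A := by
  rw [trPow_eq_sum_eigenvalues q hA.1]
  exact Finset.sum_nonneg fun i _ => Real.rpow_nonneg (hA.eigenvalues_nonneg i) _

lemma trace_re_eq_sum_eigenvalues {A : Matrix n n ℂ} (hA : A.IsHermitian) :
    A.trace.re = ∑ i, hA.eigenvalues i := by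
  rw [hA.trace_eq_sum_eigenvalues]
  simp

/-- Diagonal entries of a Hermitian matrix in an orthonormal basis average its eigenvalues. -/
lemma diag_conj_eq_sum {A : Matrix n n ℂ} (hA : A.IsHermitian) (U : unitaryGroup n ℂ) (j : n) :
    ((star U : Matrix n n ℂ) * A * (U : Matrix n n ℂ)) j j =
      ∑ k, ((‖((star U : Matrix n n ℂ) * (hA.eigenvectorUnitary : Matrix n n ℂ)) j k‖ ^ 2 *
        hA.eigenvalues k : ℝ) : ℂ) := by
  have h : (star U : Matrix n n ℂ) * A * (U : Matrix n n ℂ) =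
      ((star U : Matrix n n ℂ) * (hA.eigenvectorUnitary : Matrix n n ℂ)) *
        diagonal (RCLike.ofReal ∘ hA.eigenvalues) *
          ((star U : Matrix n n ℂ) * (hA.eigenvectorUnitary : Matrix n n ℂ))ᴴ := by
    conv_lhs => rw [hA.spectral_theorem, Unitary.conjStarAlgAut_apply]
    simp [conjTranspose_mul, star_eq_conjTranspose, Matrix.mul_assoc]
  rw [h, Matrix.mul_apply]
  refine Finset.sum_congr rfl fun k _ => ?_
  rw [mul_diagonal, conjTranspose_apply]
  push_cast
  rw [← Complex.mul_conj']
  simp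
  ring

lemma sum_norm_sq_row (U : unitaryGroup n ℂ) (j : n) :
    ∑ k, ‖(U : Matrix n n ℂ) j k‖ ^ 2 = 1 := by
  have h := congrFun (congrFun (mem_unitaryGroup_iff.mp U.2) j) j
  rw [Matrix.mul_apply] at h
  simp only [star_apply, one_apply_eq, RCLike.star_def, Complex.mul_conj'] at h
  exact_mod_cast h

lemma sum_norm_sq_col (U : unitaryGroup n ℂ) (k : n) :
    ∑ j, ‖(U : Matrix n n ℂ) j k‖ ^ 2 = 1 := by
  have h := sum_norm_sq_row (star U) k
  simpa using h

/-- Schur's observation: the weights are the squared moduli of the entries of a unitary, hence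
doubly stochastic. Row sums permit Jensen; column sums recover the full eigenvalue sum. -/
lemma exists_unistochastic_diag {A : Matrix n n ℂ} (hA : A.IsHermitian) (U : unitaryGroup n ℂ) :
    ∃ w : n → n → ℝ, (∀ j k, 0 ≤ w j k) ∧ (∀ j, ∑ k, w j k = 1) ∧ (∀ k, ∑ j, w j k = 1) ∧
      ∀ j, (((star U : Matrix n n ℂ) * A * (U : Matrix n n ℂ)) j j).re =
        ∑ k, w j k * hA.eigenvalues k := by
  refine ⟨fun j k => ‖((star U * hA.eigenvectorUnitary : unitaryGroup n ℂ) : Matrix n n ℂ) j k‖ ^ 2,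
    fun j k => by positivity, fun j => sum_norm_sq_row _ j, fun k => sum_norm_sq_col _ k,
    fun j => ?_⟩
  rw [diag_conj_eq_sum hA, ← Complex.ofReal_sum, Complex.ofReal_re]
  rfl

lemma sum_diag_rpow_le_trPow {q : ℝ} (hq : 1 ≤ q) {A : Matrix n n ℂ} (hA : A.PosSemidef)
    (U : unitaryGroup n ℂ) :
    ∑ j, (((star U : Matrix n n ℂ) * A * (U : Matrix n n ℂ)) j j).re ^ q ≤ trPow q A := by
  obtain ⟨w, h0, hr, hc, hd⟩ := exists_unistochastic_diag hA.1 U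
  rw [trPow_eq_sum_eigenvalues q hA.1]
  calc _ ≤ ∑ j, ∑ k, w j k * hA.1.eigenvalues k ^ q := by
        refine Finset.sum_le_sum fun j _ => ?_
        rw [hd]
        exact (convexOn_rpow hq).map_sum_le (fun k _ => h0 j k) (hr j)
          fun k _ => hA.eigenvalues_nonneg k
    _ = _ := by
        rw [Finset.sum_comm]
        simp [← Finset.sum_mul, hc]

lemma trPow_le_sum_diag_rpow {q : ℝ} (hq0 : 0 ≤ q) (hq : q ≤ 1) {A : Matrix n n ℂ}
    (hA : A.PosSemidef) (U : unitaryGroup n ℂ) :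
    trPow q A ≤ ∑ j, (((star U : Matrix n n ℂ) * A * (U : Matrix n n ℂ)) j j).re ^ q := by
  obtain ⟨w, h0, hr, hc, hd⟩ := exists_unistochastic_diag hA.1 U
  rw [trPow_eq_sum_eigenvalues q hA.1]
  calc _ = ∑ j, ∑ k, w j k * hA.1.eigenvalues k ^ q := by
        rw [Finset.sum_comm]
        simp [← Finset.sum_mul, hc]
    _ ≤ _ := by
        refine Finset.sum_le_sum fun j _ => ?_
        rw [hd]
        exact (Real.concaveOn_rpow hq0 hq).le_map_sum (fun k _ => h0 j k) (hr j)
          fun k _ => hA.eigenvalues_nonneg k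

lemma diag_eigenvectorUnitary {A : Matrix n n ℂ} (hA : A.IsHermitian) (j : n) :
    (((star hA.eigenvectorUnitary : Matrix n n ℂ) * A *
      (hA.eigenvectorUnitary : Matrix n n ℂ)) j j).re =
      hA.eigenvalues j := by
  have h := hA.conjStarAlgAut_star_eigenvectorUnitary
  rw [Unitary.conjStarAlgAut_star_apply] at h
  rw [h]
  simp

lemma sum_rpow_sum_le {ι κ : Type*} {r : ℝ} (hr : 1 ≤ r) (s : Finset ι) (t : Finset κ)
    (u : κ → ι → ℝ) (hu : ∀ j i, 0 ≤ u j i) :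
    (∑ i ∈ s, (∑ j ∈ t, u j i) ^ r) ^ (1 / r) ≤ ∑ j ∈ t, (∑ i ∈ s, u j i ^ r) ^ (1 / r) := by
  classical
  have hr0 : r ≠ 0 := by positivity
  induction t using Finset.induction_on with
  | empty => simp [Real.zero_rpow, hr0]
  | insert a t ha ih =>
    have h := Real.Lp_add_le s (u a) (fun i => ∑ j ∈ t, u j i) hr
    have h0 : ∀ i, 0 ≤ ∑ j ∈ t, u j i := fun i => Finset.sum_nonneg fun j _ => hu j i
    simp only [abs_of_nonneg (add_nonneg (hu a _) (h0 _)), abs_of_nonneg (hu a _),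
      abs_of_nonneg (h0 _)] at h
    simp only [Finset.sum_insert ha]
    linarith

/-- The reverse Minkowski inequality for exponents at most one. -/
lemma add_rpow_le_rpow_add {ι : Type*} {q : ℝ} (hq0 : 0 < q) (hq : q ≤ 1) (s : Finset ι)
    (x y : ι → ℝ) (hx : ∀ i, 0 ≤ x i) (hy : ∀ i, 0 ≤ y i) :
    (∑ i ∈ s, x i ^ q) ^ (1 / q) + (∑ i ∈ s, y i ^ q) ^ (1 / q) ≤
      (∑ i ∈ s, (x i + y i) ^ q) ^ (1 / q) := by
  have hr : 1 ≤ 1 / q := (one_le_div hq0).2 hq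
  -- Minkowski with exponent `1 / q ≥ 1` for the two-component vectors `(x i ^ q, y i ^ q)`, summed
  -- over `i`; raising the result to the power `1 / q` gives the claim.
  have h := sum_rpow_sum_le hr (Finset.univ : Finset Bool) s
    (fun i b => cond b (x i ^ q) (y i ^ q))
    (fun i b => by cases b <;> simp [Real.rpow_nonneg, hx, hy])
  simp only [Fintype.sum_bool, cond_true, cond_false, one_div_one_div] at h
  have e : ∀ z : ℝ, 0 ≤ z → (z ^ q) ^ (1 / q) = z := fun z hz => by
    rw [← Real.rpow_mul hz, mul_one_div_cancel hq0.ne', Real.rpow_one]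
  simp only [e _ (hx _), e _ (hy _)] at h
  have hX := Finset.sum_nonneg fun i (_ : i ∈ s) => Real.rpow_nonneg (hx i) q
  have hY := Finset.sum_nonneg fun i (_ : i ∈ s) => Real.rpow_nonneg (hy i) q
  have h2 := Real.rpow_le_rpow (by positivity) h (one_div_nonneg.2 hq0.le)
  rwa [← Real.rpow_mul (by positivity), mul_one_div_cancel hq0.ne', Real.rpow_one] at h2

/-- The Schatten `q`-norm of a positive semidefinite matrix. -/
def schatten (q : ℝ) (A : Matrix n n ℂ) : ℝ := trPow q A ^ (1 / q)

lemma schatten_nonneg (q : ℝ) {A : Matrix n n ℂ} (hA : A.PosSemidef) : 0 ≤ schatten q A :=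
  Real.rpow_nonneg (trPow_nonneg q hA) _

lemma schatten_smul {q c : ℝ} (hq : q ≠ 0) (hc : 0 ≤ c) {A : Matrix n n ℂ} (hA : A.PosSemidef) :
    schatten q ((c : ℂ) • A) = c * schatten q A := by
  rw [schatten, trPow_smul hc hA, Real.mul_rpow (Real.rpow_nonneg hc _) (trPow_nonneg q hA),
    ← Real.rpow_mul hc, mul_one_div_cancel hq, Real.rpow_one, schatten]

lemma conj_diag_re_nonneg {A : Matrix n n ℂ} (hA : A.PosSemidef) (U : unitaryGroup n ℂ) (j : n) :
    0 ≤ (((star U : Matrix n n ℂ) * A * (U : Matrix n n ℂ)) j j).re := by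
  have h := (hA.conjTranspose_mul_mul_same (U : Matrix n n ℂ)).diag_nonneg (i := j)
  exact (Complex.le_def.1 h).1

/-- In an eigenbasis of `A + B` its eigenvalues are sums of diagonal entries of `A` and `B`. Scalar
Minkowski applies to these, and passing to the diagonal does not increase the `q`-norm of either
summand. -/
lemma schatten_add_le {q : ℝ} (hq : 1 ≤ q) {A B : Matrix n n ℂ} (hA : A.PosSemidef)
    (hB : B.PosSemidef) : schatten q (A + B) ≤ schatten q A + schatten q B := by
  have hq0 : 0 ≤ 1 / q := by positivity
  set U := (hA.add hB).1.eigenvectorUnitary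
  have hAB : trPow q (A + B) = ∑ j, ((((star U : Matrix n n ℂ) * A * (U : Matrix n n ℂ)) j j).re +
      (((star U : Matrix n n ℂ) * B * (U : Matrix n n ℂ)) j j).re) ^ q := by
    rw [trPow_eq_sum_eigenvalues q (hA.add hB).1]
    simp only [← diag_eigenvectorUnitary (hA.add hB).1, Matrix.mul_add, Matrix.add_mul,
      Matrix.add_apply, Complex.add_re]
    rfl
  have h := Real.Lp_add_le Finset.univ
    (fun j => (((star U : Matrix n n ℂ) * A * (U : Matrix n n ℂ)) j j).re)
    (fun j => (((star U : Matrix n n ℂ) * B * (U : Matrix n n ℂ)) j j).re) hq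
  have hA' := conj_diag_re_nonneg hA U
  have hB' := conj_diag_re_nonneg hB U
  simp only [abs_of_nonneg (add_nonneg (hA' _) (hB' _)), abs_of_nonneg (hA' _),
    abs_of_nonneg (hB' _)] at h
  rw [schatten, hAB]
  refine h.trans (add_le_add ?_ ?_)
  · exact Real.rpow_le_rpow (Finset.sum_nonneg fun j _ => Real.rpow_nonneg (hA' j) _)
      (sum_diag_rpow_le_trPow hq hA U) hq0
  · exact Real.rpow_le_rpow (Finset.sum_nonneg fun j _ => Real.rpow_nonneg (hB' j) _)
      (sum_diag_rpow_le_trPow hq hB U) hq0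

lemma schatten_add_ge {q : ℝ} (hq0 : 0 < q) (hq : q ≤ 1) {A B : Matrix n n ℂ}
    (hA : A.PosSemidef) (hB : B.PosSemidef) :
    schatten q A + schatten q B ≤ schatten q (A + B) := by
  have hq0' : 0 ≤ 1 / q := by positivity
  set U := (hA.add hB).1.eigenvectorUnitary
  have hAB : trPow q (A + B) = ∑ j, ((((star U : Matrix n n ℂ) * A * (U : Matrix n n ℂ)) j j).re +
      (((star U : Matrix n n ℂ) * B * (U : Matrix n n ℂ)) j j).re) ^ q := by
    rw [trPow_eq_sum_eigenvalues q (hA.add hB).1]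
    simp only [← diag_eigenvectorUnitary (hA.add hB).1, Matrix.mul_add, Matrix.add_mul,
      Matrix.add_apply, Complex.add_re]
    rfl
  have h := add_rpow_le_rpow_add hq0 hq Finset.univ _ _ (conj_diag_re_nonneg hA U)
    (conj_diag_re_nonneg hB U)
  rw [schatten, schatten, schatten, hAB]
  refine (add_le_add ?_ ?_).trans h
  · exact Real.rpow_le_rpow (trPow_nonneg q hA) (trPow_le_sum_diag_rpow hq0.le hq hA U) hq0'
  · exact Real.rpow_le_rpow (trPow_nonneg q hB) (trPow_le_sum_diag_rpow hq0.le hq hB U) hq0'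

end TracePower

lemma posSemidef_trace_re_nonneg {n : Type*} [Fintype n] {R : Matrix n n ℂ}
    (hR : R.PosSemidef) : 0 ≤ R.trace.re :=
  (Complex.le_def.1 hR.trace_nonneg).1

lemma posSemidef_ofReal_trace_re {n : Type*} [Fintype n] {R : Matrix n n ℂ} (hR : R.PosSemidef) :
    (R.trace.re : ℂ) = R.trace :=
  Complex.ext rfl (Complex.le_def.1 hR.trace_nonneg).2

lemma posSemidef_eq_zero_of_trace_re {n : Type*} [Fintype n] {R : Matrix n n ℂ} (hR : R.PosSemidef)
    (h : R.trace.re = 0) : R = 0 := by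
  rw [← hR.trace_eq_zero_iff, ← posSemidef_ofReal_trace_re hR, h, Complex.ofReal_zero]

lemma posSemidef_ofReal_smul {n : Type*} {R : Matrix n n ℂ} (hR : R.PosSemidef) {c : ℝ} (hc : 0 ≤ c) :
    ((c : ℂ) • R).PosSemidef :=
  hR.smul (by exact_mod_cast hc)

lemma isDensity_normalize {n : Type*} [Fintype n] {R : Matrix n n ℂ} (hR : R.PosSemidef) (h : R.trace.re ≠ 0) :
    IsDensity (((R.trace.re⁻¹ : ℝ) : ℂ) • R) := by
  refine ⟨posSemidef_ofReal_smul hR (inv_nonneg.2 (posSemidef_trace_re_nonneg hR)), ?_⟩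
  rw [trace_smul, ← posSemidef_ofReal_trace_re hR, smul_eq_mul, ← Complex.ofReal_mul]
  simp [h]

/-! ### The homogeneous entropy on positive semidefinite matrices and its superadditivity. -/

section LocalEntropy

variable {m n : Type*} [Fintype m] [DecidableEq m] [Fintype n] [DecidableEq n]

/-- The two parameter regimes in which the concurrence is defined. -/
def Admissible (q s : ℝ) : Prop := RegimeOne q s ∨ RegimeTwo q s

lemma Admissible.q_pos {q s : ℝ} (h : Admissible q s) : 0 < q := by
  rcases h with h | h
  · linarith [h.1]
  · exact h.1.1

lemma Admissible.s_pos {q s : ℝ} (h : Admissible q s) : 0 < s := by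
  have h0 : 0 < q * s := by
    rcases h with h | h
    · linarith [h.2]
    · exact h.2.1
  exact (pos_iff_pos_of_mul_pos h0).1 h.q_pos

lemma signFactor_of_regimeOne {q s : ℝ} (h : RegimeOne q s) : signFactor q s = 1 := by
  simp [signFactor, h]

lemma signFactor_of_regimeTwo {q s : ℝ} (h : RegimeTwo q s) : signFactor q s = -1 := by
  have h' : ¬ RegimeOne q s := fun h1 => by linarith [h1.1, h.1.2]
  simp [signFactor, h, h']

/-- The positively homogeneous extension of `ρ ↦ ε (1 - (tr ρ ^ q) ^ s)` from density matrices to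
positive semidefinite matrices. -/
def localEntropy (q s : ℝ) (R : Matrix n n ℂ) : ℝ :=
  signFactor q s * (R.trace.re - R.trace.re * (schatten q R / R.trace.re) ^ (q * s))

@[simp] lemma localEntropy_zero (q s : ℝ) : localEntropy q s (0 : Matrix n n ℂ) = 0 := by
  simp [localEntropy]

lemma localEntropy_of_isDensity {q s : ℝ} (hq : 0 < q) {R : Matrix n n ℂ} (hR : IsDensity R) :
    localEntropy q s R = signFactor q s * (1 - trPow q R ^ s) := by
  rw [localEntropy, hR.2, schatten]
  simp only [Complex.one_re, div_one, one_mul]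
  rw [← Real.rpow_mul (trPow_nonneg q hR.1), ← mul_assoc, one_div_mul_cancel hq.ne', one_mul]

lemma localEntropy_smul {q s c : ℝ} (hq : 0 < q) (hc : 0 ≤ c) {R : Matrix n n ℂ}
    (hR : R.PosSemidef) : localEntropy q s ((c : ℂ) • R) = c * localEntropy q s R := by
  rcases hc.eq_or_lt with rfl | hc'
  · simp
  · have ht : ((c : ℂ) • R).trace.re = c * R.trace.re := by simp [trace_smul]
    rw [localEntropy, localEntropy, ht, schatten_smul hq.ne' hc hR,
      mul_div_mul_left _ _ hc'.ne']
    ring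

lemma trPow_le_one {q : ℝ} (hq : 1 ≤ q) {R : Matrix n n ℂ} (hR : IsDensity R) :
    trPow q R ≤ 1 := by
  have ht := trace_re_eq_sum_eigenvalues hR.1.1
  replace ht := (congrArg Complex.re hR.2).symm.trans ht
  rw [Complex.one_re] at ht
  rw [trPow_eq_sum_eigenvalues q hR.1.1, ht]
  have h0 := hR.1.eigenvalues_nonneg
  refine Finset.sum_le_sum fun i _ => Real.rpow_le_self_of_le_one (h0 i) ?_ hq
  rw [ht]
  exact Finset.single_le_sum (fun j _ => h0 j) (Finset.mem_univ i)

lemma one_le_trPow {q : ℝ} (hq : q ≤ 1) {R : Matrix n n ℂ} (hR : IsDensity R) :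
    1 ≤ trPow q R := by
  have ht := trace_re_eq_sum_eigenvalues hR.1.1
  replace ht := (congrArg Complex.re hR.2).symm.trans ht
  rw [Complex.one_re] at ht
  rw [trPow_eq_sum_eigenvalues q hR.1.1, ht]
  have h0 := hR.1.eigenvalues_nonneg
  refine Finset.sum_le_sum fun i _ => Real.self_le_rpow_of_le_one (h0 i) ?_ hq
  rw [ht]
  exact Finset.single_le_sum (fun j _ => h0 j) (Finset.mem_univ i)

lemma localEntropy_nonneg_of_isDensity {q s : ℝ} (h : Admissible q s) {R : Matrix n n ℂ}
    (hR : IsDensity R) : 0 ≤ localEntropy q s R := by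
  rw [localEntropy_of_isDensity h.q_pos hR]
  have hs := h.s_pos.le
  rcases h with h' | h'
  · rw [signFactor_of_regimeOne h', one_mul, sub_nonneg]
    exact Real.rpow_le_one (trPow_nonneg q hR.1) (trPow_le_one h'.1 hR) hs
  · rw [signFactor_of_regimeTwo h']
    have := Real.one_le_rpow (one_le_trPow h'.1.2.le hR) hs
    linarith

lemma localEntropy_nonneg {q s : ℝ} (h : Admissible q s) {R : Matrix n n ℂ}
    (hR : R.PosSemidef) : 0 ≤ localEntropy q s R := by
  by_cases ht : R.trace.re = 0
  · rw [posSemidef_eq_zero_of_trace_re hR ht, localEntropy_zero]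
  · have h1 := localEntropy_nonneg_of_isDensity h (isDensity_normalize hR ht)
    have h0 := posSemidef_trace_re_nonneg hR
    rw [localEntropy_smul h.q_pos (inv_nonneg.2 h0) hR] at h1
    exact nonneg_of_mul_nonneg_right h1 (inv_pos.2 (h0.lt_of_ne' ht))

/-- Concavity of the entropy in homogeneous form. The (reverse) triangle inequality is combined with
convexity (concavity) of `x ^ (q * s)` at the normalised norms, weighted by the relative traces. -/
lemma localEntropy_add_ge {q s : ℝ} (h : Admissible q s) {A B : Matrix n n ℂ}
    (hA : A.PosSemidef) (hB : B.PosSemidef) :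
    localEntropy q s A + localEntropy q s B ≤ localEntropy q s (A + B) := by
  by_cases htA : A.trace.re = 0
  · simp [posSemidef_eq_zero_of_trace_re hA htA]
  by_cases htB : B.trace.re = 0
  · simp [posSemidef_eq_zero_of_trace_re hB htB]
  have hA0 := (posSemidef_trace_re_nonneg hA).lt_of_ne' htA
  have hB0 := (posSemidef_trace_re_nonneg hB).lt_of_ne' htB
  have hNA := schatten_nonneg q hA
  have hNB := schatten_nonneg q hB
  have hN := schatten_nonneg q (hA.add hB)
  simp only [localEntropy, trace_add, Complex.add_re]
  set x := A.trace.re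
  set y := B.trace.re
  have hw : x / (x + y) + y / (x + y) = 1 := by field_simp
  have hmix : x / (x + y) * (schatten q A / x) + y / (x + y) * (schatten q B / y) =
      (schatten q A + schatten q B) / (x + y) := by field_simp
  have hscale : ∀ u v : ℝ, (x + y) * (x / (x + y) * u + y / (x + y) * v) = x * u + y * v := by
    intro u v; field_simp
  have hxy : 0 < x + y := by positivity
  rcases h with h' | h'
  · rw [signFactor_of_regimeOne h']
    have hm : 0 ≤ q * s := by linarith [h'.2]
    have h1 := Real.rpow_le_rpow (div_nonneg hN hxy.le)
      (div_le_div_of_nonneg_right (schatten_add_le h'.1 hA hB) hxy.le) hm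
    have h2 := (convexOn_rpow h'.2).2 (x := schatten q A / x) (y := schatten q B / y)
      (div_nonneg hNA hA0.le) (div_nonneg hNB hB0.le) (div_nonneg hA0.le hxy.le)
      (div_nonneg hB0.le hxy.le) hw
    simp only [smul_eq_mul, hmix] at h2
    have h3 := mul_le_mul_of_nonneg_left (h1.trans h2) hxy.le
    rw [hscale] at h3
    linarith
  · rw [signFactor_of_regimeTwo h']
    have h1 := Real.rpow_le_rpow (div_nonneg (add_nonneg hNA hNB) hxy.le)
      (div_le_div_of_nonneg_right (schatten_add_ge h'.1.1 h'.1.2.le hA hB) hxy.le) h'.2.1.le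
    have h2 := (Real.concaveOn_rpow h'.2.1.le h'.2.2.le).2 (x := schatten q A / x)
      (y := schatten q B / y)
      (div_nonneg hNA hA0.le) (div_nonneg hNB hB0.le) (div_nonneg hA0.le hxy.le)
      (div_nonneg hB0.le hxy.le) hw
    simp only [smul_eq_mul, hmix] at h2
    have h3 := mul_le_mul_of_nonneg_left (h2.trans h1) hxy.le
    rw [hscale] at h3
    linarith

lemma sum_localEntropy_le {q s : ℝ} (h : Admissible q s) {κ : Type*} (t : Finset κ)
    (R : κ → Matrix n n ℂ) (hR : ∀ k, (R k).PosSemidef) :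
    ∑ k ∈ t, localEntropy q s (R k) ≤ localEntropy q s (∑ k ∈ t, R k) := by
  classical
  induction t using Finset.induction_on with
  | empty => simp
  | insert a t ha ih =>
    rw [Finset.sum_insert ha, Finset.sum_insert ha]
    exact (add_le_add_right ih _).trans
      (localEntropy_add_ge h (hR a) (posSemidef_sum t fun k _ => hR k))

/-- The two reduced states of a pure state have the same nonzero spectrum. This exchanges the roles
of Alice and Bob. -/
lemma localEntropy_mul_conjTranspose {q s : ℝ} (hq : q ≠ 0) (V : Matrix m n ℂ) :
    localEntropy q s (V * Vᴴ) = localEntropy q s (Vᵀ * Vᵀᴴ) := by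
  have hT : Vᵀ * Vᵀᴴ = (Vᴴ * V)ᵀ := by
    rw [transpose_mul]; rfl
  rw [hT, localEntropy, localEntropy, schatten, schatten,
    trPow_transpose q (isHermitian_conjTranspose_mul_self V),
    trPow_mul_comm hq V Vᴴ (isHermitian_mul_conjTranspose_self V)
      (isHermitian_conjTranspose_mul_self V), trace_transpose, trace_mul_comm]

end LocalEntropy

/-! ### Pure states under local measurements. -/

section PureStates

variable {a b : ℕ}

/-- The coefficient matrix of a bipartite vector. -/
def coeffMatrix (v : Fin a × Fin b → ℂ) : Matrix (Fin a) (Fin b) ℂ := Matrix.of fun i k => v (i, k)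

lemma reduceA_ketbra (v : Fin a × Fin b → ℂ) :
    reduceA (ketbra v) = coeffMatrix v * (coeffMatrix v)ᴴ := by
  ext i j
  simp [reduceA, ketbra, coeffMatrix, vecMulVec_apply, Matrix.mul_apply]

lemma posSemidef_reduceA_ketbra (v : Fin a × Fin b → ℂ) : (reduceA (ketbra v)).PosSemidef := by
  rw [reduceA_ketbra]
  exact posSemidef_self_mul_conjTranspose _

lemma posSemidef_ketbra {n : Type*} [Fintype n] (v : n → ℂ) : (ketbra v).PosSemidef :=
  posSemidef_vecMulVec_self_star v

lemma trace_ketbra {n : Type*} [Fintype n] (v : n → ℂ) : (ketbra v).trace = star v ⬝ᵥ v := by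
  rw [ketbra, trace_vecMulVec, dotProduct_comm]

lemma trace_reduceA (X : BiMatrix a b) : (reduceA X).trace = X.trace := by
  simp [reduceA, Matrix.trace, Fintype.sum_prod_type]

lemma ketbra_smul {n : Type*} (c : ℝ) (v : n → ℂ) :
    ketbra ((c : ℂ) • v) = ((c ^ 2 : ℝ) : ℂ) • ketbra v := by
  ext i j
  simp [ketbra, vecMulVec_apply]
  ring

lemma reduceA_smul (c : ℂ) (X : BiMatrix a b) : reduceA (c • X) = c • reduceA X := by
  ext i j
  simp [reduceA, Finset.mul_sum]

/-- The pure-state concurrence, extended to unnormalised vectors by homogeneity. -/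
def vecConcurrence (q s : ℝ) (v : Fin a × Fin b → ℂ) : ℝ := localEntropy q s (reduceA (ketbra v))

lemma vecConcurrence_of_isUnitVec {q s : ℝ} (hq : 0 < q) {v : Fin a × Fin b → ℂ}
    (hv : IsUnitVec v) : vecConcurrence q s v = pureConcurrence q s v := by
  rw [vecConcurrence, pureConcurrence, localEntropy_of_isDensity hq]
  exact ⟨posSemidef_reduceA_ketbra v, by rw [trace_reduceA, trace_ketbra, hv]⟩

lemma vecConcurrence_smul {q s : ℝ} (hq : 0 < q) (c : ℝ) (v : Fin a × Fin b → ℂ) :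
    vecConcurrence q s ((c : ℂ) • v) = c ^ 2 * vecConcurrence q s v := by
  rw [vecConcurrence, ketbra_smul, reduceA_smul,
    localEntropy_smul hq (sq_nonneg c) (posSemidef_reduceA_ketbra v), vecConcurrence]

lemma vecConcurrence_nonneg {q s : ℝ} (h : Admissible q s) (v : Fin a × Fin b → ℂ) :
    0 ≤ vecConcurrence q s v :=
  localEntropy_nonneg h (posSemidef_reduceA_ketbra v)

lemma coeffMatrix_kronecker_one_mulVec {c : ℕ} (K : Matrix (Fin c) (Fin a) ℂ)
    (v : Fin a × Fin b → ℂ) :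
    coeffMatrix ((K ⊗ₖ (1 : Matrix (Fin b) (Fin b) ℂ)) *ᵥ v) = K * coeffMatrix v := by
  ext i k
  simp [coeffMatrix, mulVec, dotProduct, Matrix.mul_apply, Fintype.sum_prod_type, one_apply]

lemma coeffMatrix_one_kronecker_mulVec {c : ℕ} (K : Matrix (Fin c) (Fin b) ℂ)
    (v : Fin a × Fin b → ℂ) :
    coeffMatrix (((1 : Matrix (Fin a) (Fin a) ℂ) ⊗ₖ K) *ᵥ v) = coeffMatrix v * Kᵀ := by
  ext i k
  simp only [coeffMatrix, mulVec, dotProduct, Matrix.mul_apply, Fintype.sum_prod_type, one_apply,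
    of_apply, kronecker_apply, transpose_apply]
  rw [Finset.sum_comm]
  simp [mul_comm]

/-- A local operation on the traced-out system does not increase the local entropy on average. -/
lemma sum_localEntropy_mul_transpose_le {q s : ℝ} (h : Admissible q s) {m n : Type*}
    [Fintype m] [DecidableEq m] [Fintype n] [DecidableEq n] {κ : Type*} [Fintype κ] {c : κ → ℕ}
    (K : (k : κ) → Matrix (Fin (c k)) n ℂ) (hK : ∑ k, (K k)ᴴ * K k = 1) (V : Matrix m n ℂ) :
    ∑ k, localEntropy q s ((V * (K k)ᵀ) * (V * (K k)ᵀ)ᴴ) ≤ localEntropy q s (V * Vᴴ) := by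
  refine (sum_localEntropy_le h Finset.univ _
    fun k => posSemidef_self_mul_conjTranspose _).trans_eq ?_
  congr 1
  -- Bob's operators act on `V` from the right as transposes, so the completeness relation is needed
  -- in transposed form; it makes the pieces add up to `V * Vᴴ`.
  have hK' : ∑ k, (K k)ᵀ * (K k)ᵀᴴ = 1 := by
    have := congrArg Matrix.transpose hK
    rw [transpose_sum, transpose_one] at this
    simp only [transpose_mul] at this
    exact this
  calc _ = V * (∑ k, (K k)ᵀ * (K k)ᵀᴴ) * Vᴴ := by
        simp [Matrix.mul_sum, Matrix.sum_mul, conjTranspose_mul, Matrix.mul_assoc]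
    _ = _ := by rw [hK', Matrix.mul_one]

lemma sum_vecConcurrence_bob_le {q s : ℝ} (h : Admissible q s) {m : ℕ} {c r : Fin m → ℕ}
    {K : (i : Fin m) → Fin (r i) → Matrix (Fin (c i)) (Fin b) ℂ} (hK : IsInstrument K)
    (v : Fin a × Fin b → ℂ) :
    ∑ i, ∑ l, vecConcurrence q s (((1 : Matrix (Fin a) (Fin a) ℂ) ⊗ₖ K i l) *ᵥ v) ≤
      vecConcurrence q s v := by
  simp only [vecConcurrence, reduceA_ketbra, coeffMatrix_one_kronecker_mulVec]
  -- Outcome and Kraus index are merged into one index, as if every Kraus operator were a separate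
  -- outcome.
  rw [IsInstrument, ← Fintype.sum_sigma'] at hK
  rw [← Fintype.sum_sigma' (fun i l => localEntropy q s
    (coeffMatrix v * (K i l)ᵀ * (coeffMatrix v * (K i l)ᵀ)ᴴ))]
  exact sum_localEntropy_mul_transpose_le h (fun x : (i : Fin m) × Fin (r i) => K x.1 x.2) hK _

lemma sum_vecConcurrence_alice_le {q s : ℝ} (h : Admissible q s) {m : ℕ} {c r : Fin m → ℕ}
    {K : (i : Fin m) → Fin (r i) → Matrix (Fin (c i)) (Fin a) ℂ} (hK : IsInstrument K)
    (v : Fin a × Fin b → ℂ) :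
    ∑ i, ∑ l, vecConcurrence q s ((K i l ⊗ₖ (1 : Matrix (Fin b) (Fin b) ℂ)) *ᵥ v) ≤
      vecConcurrence q s v := by
  simp only [vecConcurrence, reduceA_ketbra, coeffMatrix_kronecker_one_mulVec]
  simp only [fun i l => localEntropy_mul_conjTranspose (s := s) h.q_pos.ne'
    (K i l * coeffMatrix v), transpose_mul]
  rw [localEntropy_mul_conjTranspose h.q_pos.ne']
  rw [IsInstrument, ← Fintype.sum_sigma'] at hK
  rw [← Fintype.sum_sigma' (fun i l => localEntropy q s
    ((coeffMatrix v)ᵀ * (K i l)ᵀ * ((coeffMatrix v)ᵀ * (K i l)ᵀ)ᴴ))]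
  exact sum_localEntropy_mul_transpose_le h (fun x : (i : Fin m) × Fin (r i) => K x.1 x.2) hK _

end PureStates

/-! ### The convex roof over unnormalised vectors. -/

section Roof

variable {a b : ℕ}

/-- The values of the convex roof over decompositions into unnormalised vectors. -/
def vecRoofValues (q s : ℝ) (X : BiMatrix a b) : Set ℝ :=
  {c | ∃ (n : ℕ) (v : Fin n → Fin a × Fin b → ℂ),
    X = ∑ i, ketbra (v i) ∧ c = ∑ i, vecConcurrence q s (v i)}

/-- The concurrence, extended to positive semidefinite operators by homogeneity. -/
def roof (q s : ℝ) (X : BiMatrix a b) : ℝ := sInf (vecRoofValues q s X)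

lemma exists_unit_smul {n : Type*} [Fintype n] (v : n → ℂ) (hv : v ≠ 0) :
    ∃ (c : ℝ) (ψ : n → ℂ), IsUnitVec ψ ∧ v = (c : ℂ) • ψ := by
  have ht : (ketbra v).trace.re ≠ 0 := fun h => hv <| by
    have := posSemidef_eq_zero_of_trace_re (posSemidef_ketbra v) h
    simpa [ketbra] using this
  have h0 := (posSemidef_trace_re_nonneg (posSemidef_ketbra v)).lt_of_ne' ht
  set t := (ketbra v).trace.re with htdef
  have hs : Real.sqrt t ≠ 0 := (Real.sqrt_pos.2 h0).ne'
  refine ⟨Real.sqrt t, (((Real.sqrt t)⁻¹ : ℝ) : ℂ) • v, ?_, ?_⟩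
  · rw [IsUnitVec, ← trace_ketbra, ketbra_smul, trace_smul,
      ← posSemidef_ofReal_trace_re (posSemidef_ketbra v), ← htdef, inv_pow, Real.sq_sqrt h0.le,
      smul_eq_mul, ← Complex.ofReal_mul, inv_mul_cancel₀ ht, Complex.ofReal_one]
  · rw [smul_smul, ← Complex.ofReal_mul, mul_inv_cancel₀ hs, Complex.ofReal_one, one_smul]

/-- A weight `p` is absorbed into its vector as the factor `√p`; conversely the squared norms of the
vectors serve as weights, and sum to one because the trace is one. -/
lemma roofValues_eq {q s : ℝ} (hq : 0 < q) {ρ : BiMatrix a b} (hρ : IsDensity ρ) :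
    roofValues q s ρ = vecRoofValues q s ρ := by
  ext c
  constructor
  · rintro ⟨n, p, ψ, ⟨hp, hψ, rfl⟩, rfl⟩
    refine ⟨n, fun i => (Real.sqrt (p i) : ℂ) • ψ i, ?_, ?_⟩
    · simp_rw [ketbra_smul, Real.sq_sqrt (hp.1 _)]
    · simp_rw [vecConcurrence_smul hq, Real.sq_sqrt (hp.1 _),
        vecConcurrence_of_isUnitVec hq (hψ _)]
  · rintro ⟨n, v, rfl, rfl⟩
    -- A zero vector gets weight zero but still needs some unit vector. One exists because trace one
    -- excludes that all `v i` vanish.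
    obtain ⟨e, he⟩ : ∃ e : Fin a × Fin b → ℂ, IsUnitVec e := by
      obtain ⟨i, hi⟩ : ∃ i, v i ≠ 0 := by
        by_contra! h
        have := hρ.2
        simp [h, ketbra] at this
      obtain ⟨_, ψ, h, _⟩ := exists_unit_smul (v i) hi
      exact ⟨ψ, h⟩
    have hv : ∀ i, ∃ (c : ℝ) (ψ : Fin a × Fin b → ℂ), IsUnitVec ψ ∧ v i = (c : ℂ) • ψ := by
      intro i
      by_cases h : v i = 0
      · exact ⟨0, e, he, by simp [h]⟩
      · exact exists_unit_smul _ h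
    choose c ψ hψ hc using hv
    refine ⟨n, fun i => c i ^ 2, ψ, ⟨⟨fun i => sq_nonneg _, ?_⟩, hψ, ?_⟩, ?_⟩
    · have h := hρ.2
      simp_rw [hc, ketbra_smul, trace_sum, trace_smul, trace_ketbra] at h
      have hψ' : ∀ i, star (ψ i) ⬝ᵥ ψ i = 1 := hψ
      simp only [hψ', smul_eq_mul, mul_one] at h
      exact_mod_cast h
    · simp_rw [hc, ketbra_smul]
    · simp_rw [hc, vecConcurrence_smul hq, vecConcurrence_of_isUnitVec hq (hψ _)]

lemma concurrence_eq_roof {q s : ℝ} (hq : 0 < q) {ρ : BiMatrix a b} (hρ : IsDensity ρ) :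
    concurrence q s ρ = roof q s ρ := by
  rw [concurrence, roof, roofValues_eq hq hρ]

lemma vecRoofValues_nonempty (q s : ℝ) {X : BiMatrix a b} (hX : X.PosSemidef) :
    (vecRoofValues q s X).Nonempty := by
  obtain ⟨n, v, h⟩ := posSemidef_iff_eq_sum_vecMulVec.1 hX
  exact ⟨_, n, v, h, rfl⟩

lemma nonneg_of_mem_vecRoofValues {q s : ℝ} (h : Admissible q s) {X : BiMatrix a b} {c : ℝ}
    (hc : c ∈ vecRoofValues q s X) : 0 ≤ c := by
  obtain ⟨n, v, -, rfl⟩ := hc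
  exact Finset.sum_nonneg fun i _ => vecConcurrence_nonneg h _

lemma bddBelow_vecRoofValues {q s : ℝ} (h : Admissible q s) (X : BiMatrix a b) :
    BddBelow (vecRoofValues q s X) :=
  ⟨0, fun _ hc => nonneg_of_mem_vecRoofValues h hc⟩

lemma roof_nonneg {q s : ℝ} (h : Admissible q s) (X : BiMatrix a b) : 0 ≤ roof q s X :=
  Real.sInf_nonneg fun _ hc => nonneg_of_mem_vecRoofValues h hc

lemma roof_sum_ketbra_le {q s : ℝ} (h : Admissible q s) {κ : Type*} [Fintype κ]
    (v : κ → Fin a × Fin b → ℂ) :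
    roof q s (∑ k, ketbra (v k)) ≤ ∑ k, vecConcurrence q s (v k) := by
  refine csInf_le (bddBelow_vecRoofValues h _)
    ⟨Fintype.card κ, fun i => v ((Fintype.equivFin κ).symm i), ?_, ?_⟩
  · exact ((Fintype.equivFin κ).symm.sum_comp fun k => ketbra (v k)).symm
  · exact ((Fintype.equivFin κ).symm.sum_comp fun k => vecConcurrence q s (v k)).symm

lemma le_roof {q s r : ℝ} {X : BiMatrix a b} (hX : X.PosSemidef)
    (h : ∀ (n : ℕ) (v : Fin n → Fin a × Fin b → ℂ), X = ∑ i, ketbra (v i) →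
      r ≤ ∑ i, vecConcurrence q s (v i)) : r ≤ roof q s X := by
  refine le_csInf (vecRoofValues_nonempty q s hX) ?_
  rintro _ ⟨n, v, hv, rfl⟩
  exact h n v hv

@[simp] lemma roof_zero {q s : ℝ} (h : Admissible q s) : roof q s (0 : BiMatrix a b) = 0 := by
  refine le_antisymm ?_ (roof_nonneg h _)
  simpa using roof_sum_ketbra_le h (fun k : Empty => (k.elim : Fin a × Fin b → ℂ))

/-- Concatenating decompositions of `X` and `Y` gives one of `X + Y`. -/
lemma roof_add_le {q s : ℝ} (h : Admissible q s) {X Y : BiMatrix a b} (hX : X.PosSemidef)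
    (hY : Y.PosSemidef) : roof q s (X + Y) ≤ roof q s X + roof q s Y := by
  rw [← sub_le_iff_le_add]
  refine le_roof hX fun n v hv => ?_
  rw [sub_le_comm]
  refine le_roof hY fun m w hw => ?_
  rw [sub_le_iff_le_add']
  have := roof_sum_ketbra_le h (Sum.elim v w)
  simpa [Fintype.sum_sum_type, ← hv, ← hw] using this

lemma roof_sum_le {q s : ℝ} (h : Admissible q s) {κ : Type*} (t : Finset κ)
    (X : κ → BiMatrix a b) (hX : ∀ k, (X k).PosSemidef) :
    roof q s (∑ k ∈ t, X k) ≤ ∑ k ∈ t, roof q s (X k) := by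
  classical
  induction t using Finset.induction_on with
  | empty => simp [h]
  | insert k t hk ih =>
    rw [Finset.sum_insert hk, Finset.sum_insert hk]
    exact (roof_add_le h (hX k) (posSemidef_sum t fun k _ => hX k)).trans (add_le_add_right ih _)

lemma sum_roof_fiber_le {q s : ℝ} (h : Admissible q s) {κ κ' : Type*} [Fintype κ] [Fintype κ']
    [DecidableEq κ'] (f : κ → κ') (X : κ → BiMatrix a b) (hX : ∀ k, (X k).PosSemidef) :
    ∑ k', roof q s (∑ k with f k = k', X k) ≤ ∑ k, roof q s (X k) :=
  (Finset.sum_le_sum fun _ _ => roof_sum_le h _ _ hX).trans_eq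
    (Finset.sum_fiberwise Finset.univ f fun k => roof q s (X k))

lemma roof_smul_le {q s c : ℝ} (h : Admissible q s) (hc : 0 ≤ c) {X : BiMatrix a b}
    (hX : X.PosSemidef) : roof q s ((c : ℂ) • X) ≤ c * roof q s X := by
  rcases hc.eq_or_lt with rfl | hc'
  · simp [h]
  rw [← div_le_iff₀' hc']
  refine le_roof hX fun n v hv => ?_
  rw [div_le_iff₀' hc']
  have := roof_sum_ketbra_le h fun i => (Real.sqrt c : ℂ) • v i
  simpa only [ketbra_smul, vecConcurrence_smul h.q_pos, Real.sq_sqrt hc, ← Finset.smul_sum,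
    ← Finset.mul_sum, ← hv] using this

lemma roof_smul {q s c : ℝ} (h : Admissible q s) (hc : 0 ≤ c) {X : BiMatrix a b}
    (hX : X.PosSemidef) : roof q s ((c : ℂ) • X) = c * roof q s X := by
  rcases hc.eq_or_lt with rfl | hc'
  · simp [h]
  refine le_antisymm (roof_smul_le h hc hX) ?_
  -- The reverse bound is the same inequality for the factor `c⁻¹` applied to `c • X`.
  have h1 := roof_smul_le h (inv_nonneg.2 hc) (posSemidef_ofReal_smul hX hc)
  rw [smul_smul, ← Complex.ofReal_mul, inv_mul_cancel₀ hc'.ne', Complex.ofReal_one,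
    one_smul] at h1
  rwa [← le_inv_mul_iff₀ hc']

/-- Turns the terms of (E2) into values of `roof`. An outcome of probability zero contributes zero
on both sides. -/
lemma trace_mul_concurrence_normalize {q s : ℝ} (h : Admissible q s) {X : BiMatrix a b}
    (hX : X.PosSemidef) :
    X.trace.re * concurrence q s (X.trace⁻¹ • X) = roof q s X := by
  by_cases ht : X.trace.re = 0
  · simp [posSemidef_eq_zero_of_trace_re hX ht, h]
  · have ht0 := posSemidef_trace_re_nonneg hX
    rw [← posSemidef_ofReal_trace_re hX, ← Complex.ofReal_inv,
      concurrence_eq_roof h.q_pos (isDensity_normalize hX ht),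
      roof_smul h (inv_nonneg.2 ht0) hX, Complex.ofReal_re, mul_inv_cancel_left₀ ht]

end Roof

/-! ### Monotonicity under LOCC, by induction on the protocol. -/

section Protocols

variable {a b : ℕ}

lemma krausMap_ketbra {m n : Type*} [Fintype n] {r : ℕ} (K : Fin r → Matrix m n ℂ) (v : n → ℂ) :
    krausMap K (ketbra v) = ∑ l, ketbra (K l *ᵥ v) := by
  simp [krausMap, ketbra, mul_vecMulVec, vecMulVec_mul, star_mulVec]

lemma posSemidef_krausMap {m n : Type*} [Fintype m] [Fintype n] {r : ℕ} (K : Fin r → Matrix m n ℂ)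
    {X : Matrix n n ℂ} (hX : X.PosSemidef) : (krausMap K X).PosSemidef :=
  posSemidef_sum _ fun l _ => hX.mul_mul_conjTranspose_same (K l)

lemma posSemidef_onA {c r : ℕ} (K : Fin r → Matrix (Fin c) (Fin a) ℂ) {X : BiMatrix a b}
    (hX : X.PosSemidef) : (onA b K X).PosSemidef :=
  posSemidef_krausMap _ hX

lemma posSemidef_onB {c r : ℕ} (K : Fin r → Matrix (Fin c) (Fin b) ℂ) {X : BiMatrix a b}
    (hX : X.PosSemidef) : (onB a K X).PosSemidef :=
  posSemidef_krausMap _ hX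

lemma roof_krausMap_sum_ketbra_le {q s : ℝ} (h : Admissible q s) {c d r n : ℕ}
    (K : Fin r → Matrix (Fin c × Fin d) (Fin a × Fin b) ℂ) (v : Fin n → Fin a × Fin b → ℂ) :
    roof q s (krausMap K (∑ k, ketbra (v k)) : BiMatrix c d) ≤
      ∑ k, ∑ l, vecConcurrence q s (K l *ᵥ v k) := by
  rw [map_sum]
  simp only [krausMap_ketbra]
  refine (roof_sum_le h _ _ fun k => posSemidef_sum _ fun l _ => posSemidef_ketbra _).trans ?_
  exact Finset.sum_le_sum fun k _ => roof_sum_ketbra_le h _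

/-- Any decomposition of `X` is carried by the Kraus operators to decompositions of all the outputs,
so the pure-state bound can be summed vector by vector. -/
lemma sum_roof_onA_le {q s : ℝ} (h : Admissible q s) {m : ℕ} {c r : Fin m → ℕ}
    {K : (i : Fin m) → Fin (r i) → Matrix (Fin (c i)) (Fin a) ℂ} (hK : IsInstrument K)
    {X : BiMatrix a b} (hX : X.PosSemidef) :
    ∑ i, roof q s (onA b (K i) X) ≤ roof q s X := by
  refine le_roof hX fun n v hv => ?_
  subst hv
  refine (Finset.sum_le_sum fun i _ => roof_krausMap_sum_ketbra_le h _ v).trans ?_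
  rw [Finset.sum_comm]
  exact Finset.sum_le_sum fun k _ => sum_vecConcurrence_alice_le h hK (v k)

lemma sum_roof_onB_le {q s : ℝ} (h : Admissible q s) {m : ℕ} {c r : Fin m → ℕ}
    {K : (i : Fin m) → Fin (r i) → Matrix (Fin (c i)) (Fin b) ℂ} (hK : IsInstrument K)
    {X : BiMatrix a b} (hX : X.PosSemidef) :
    ∑ i, roof q s (onB a (K i) X) ≤ roof q s X := by
  refine le_roof hX fun n v hv => ?_
  subst hv
  refine (Finset.sum_le_sum fun i _ => roof_krausMap_sum_ketbra_le h _ v).trans ?_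
  rw [Finset.sum_comm]
  exact Finset.sum_le_sum fun k _ => sum_vecConcurrence_bob_le h hK (v k)

lemma IsLOCC.posSemidef {a' b' : ℕ} {ι : Type} {M : ι → BiMatrix a b →ₗ[ℂ] BiMatrix a' b'}
    (hM : IsLOCC M) (i : ι) {X : BiMatrix a b} (hX : X.PosSemidef) : (M i X).PosSemidef := by
  induction hM with
  | done => exact hX
  | alice K hK M hM ih => exact ih _ _ (posSemidef_onA _ hX)
  | bob K hK M hM ih => exact ih _ _ (posSemidef_onB _ hX)
  | coarse M hM f ih =>
    rw [LinearMap.sum_apply]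
    exact posSemidef_sum _ fun i _ => ih i hX

lemma IsLOCC.sum_roof_le {q s : ℝ} (h : Admissible q s) {a' b' : ℕ} {ι : Type} [Fintype ι]
    {M : ι → BiMatrix a b →ₗ[ℂ] BiMatrix a' b'} (hM : IsLOCC M) {X : BiMatrix a b}
    (hX : X.PosSemidef) : ∑ i, roof q s (M i X) ≤ roof q s X := by
  -- The outcome type changes along the induction, so its `Fintype` instance has to be generalised.
  rename_i inst
  revert inst
  induction hM with
  | done =>
    intro inst
    simp
  | alice K hK M hM ih =>
    intro inst
    obtain rfl : inst = Sigma.instFintype := Subsingleton.elim _ _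
    rw [Fintype.sum_sigma]
    exact (Finset.sum_le_sum fun i _ => ih i (posSemidef_onA _ hX)).trans
      (sum_roof_onA_le h hK hX)
  | bob K hK M hM ih =>
    intro inst
    obtain rfl : inst = Sigma.instFintype := Subsingleton.elim _ _
    rw [Fintype.sum_sigma]
    exact (Finset.sum_le_sum fun i _ => ih i (posSemidef_onB _ hX)).trans
      (sum_roof_onB_le h hK hX)
  | coarse M hM f ih =>
    intro inst
    simp only [LinearMap.sum_apply]
    exact (sum_roof_fiber_le h f _ fun i => hM.posSemidef i hX).trans (ih hX)

end Protocols

/-! ### Vanishing on separable states. -/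

section Separable

variable {a b : ℕ}

/-- A rank-one projection has spectrum in `{0, 1}`, where `x ^ q = x`. -/
lemma trPow_ketbra {n : Type*} [Fintype n] [DecidableEq n] {q : ℝ} (hq : q ≠ 0) {u : n → ℂ}
    (hu : IsUnitVec u) : trPow q (ketbra u) = 1 := by
  have hid : IsIdempotentElem (ketbra u) := by
    have hu' : star u ⬝ᵥ u = 1 := hu
    rw [IsIdempotentElem, ketbra, vecMulVec_mul_vecMulVec, hu', one_smul]
  have hsa : IsSelfAdjoint (ketbra u) := (posSemidef_ketbra u).1
  have h : cfc (fun x : ℝ => x ^ q) (ketbra u) = ketbra u := by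
    conv_rhs => rw [← cfc_id' ℝ (ketbra u)]
    refine cfc_congr fun x hx => ?_
    rcases hid.spectrum_subset ℝ hx with rfl | rfl
    · simp [hq]
    · simp
  have ht : (ketbra u).trace = 1 := (trace_ketbra u).trans hu
  rw [trPow, h, ht, Complex.one_re]

lemma localEntropy_ketbra {n : Type*} [Fintype n] [DecidableEq n] {q s : ℝ} (hq : 0 < q)
    (u : n → ℂ) : localEntropy q s (ketbra u) = 0 := by
  by_cases hu : u = 0
  · have : ketbra u = 0 := by simp [hu, ketbra]
    rw [this, localEntropy_zero]
  · obtain ⟨c, ψ, hψ, rfl⟩ := exists_unit_smul u hu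
    have hd : IsDensity (ketbra ψ) := ⟨posSemidef_ketbra ψ, (trace_ketbra ψ).trans hψ⟩
    rw [ketbra_smul, localEntropy_smul hq (sq_nonneg c) (posSemidef_ketbra ψ),
      localEntropy_of_isDensity hq hd, trPow_ketbra hq.ne' hψ]
    simp

/-- The product vector `u ⊗ w`. -/
def prodVec (u : Fin a → ℂ) (w : Fin b → ℂ) : Fin a × Fin b → ℂ := fun x => u x.1 * w x.2

lemma ketbra_prodVec (u : Fin a → ℂ) (w : Fin b → ℂ) :
    ketbra (prodVec u w) = ketbra u ⊗ₖ ketbra w := by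
  ext i j
  simp [ketbra, prodVec, vecMulVec_apply]
  ring

lemma reduceA_ketbra_prodVec (u : Fin a → ℂ) (w : Fin b → ℂ) :
    reduceA (ketbra (prodVec u w)) = (star w ⬝ᵥ w) • ketbra u := by
  ext i j
  simp only [reduceA, ketbra_prodVec, of_apply, kronecker_apply, Matrix.smul_apply, smul_eq_mul,
    ← Finset.mul_sum]
  rw [mul_comm, ← trace_ketbra]
  rfl

lemma vecConcurrence_prodVec {q s : ℝ} (hq : 0 < q) (u : Fin a → ℂ) (w : Fin b → ℂ) :
    vecConcurrence q s (prodVec u w) = 0 := by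
  have hw := posSemidef_ketbra w
  rw [vecConcurrence, reduceA_ketbra_prodVec, ← trace_ketbra, ← posSemidef_ofReal_trace_re hw,
    localEntropy_smul hq (posSemidef_trace_re_nonneg hw) (posSemidef_ketbra u),
    localEntropy_ketbra hq, mul_zero]

lemma roof_kronecker {q s : ℝ} (h : Admissible q s) {σ : Matrix (Fin a) (Fin a) ℂ}
    {τ : Matrix (Fin b) (Fin b) ℂ} (hσ : σ.PosSemidef) (hτ : τ.PosSemidef) :
    roof q s (σ ⊗ₖ τ) = 0 := by
  obtain ⟨m, u, hu⟩ := posSemidef_iff_eq_sum_vecMulVec.1 hσ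
  obtain ⟨n, w, hw⟩ := posSemidef_iff_eq_sum_vecMulVec.1 hτ
  have e : σ ⊗ₖ τ = ∑ x : Fin m × Fin n, ketbra (prodVec (u x.1) (w x.2)) := by
    simp only [ketbra_prodVec]
    ext i j
    simp only [hu, hw, ketbra, kroneckerMap_apply, Matrix.sum_apply, Finset.sum_mul_sum,
      Fintype.sum_prod_type]
  refine le_antisymm ?_ (roof_nonneg h _)
  rw [e]
  refine (roof_sum_ketbra_le h _).trans_eq ?_
  simp [vecConcurrence_prodVec h.q_pos]

lemma IsSeparable.roof_eq_zero {q s : ℝ} (h : Admissible q s) {ρ : BiMatrix a b}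
    (hρ : IsSeparable ρ) : roof q s ρ = 0 := by
  obtain ⟨n, p, σ, τ, hp, hσ, hτ, rfl⟩ := hρ
  have hst : ∀ i, (σ i ⊗ₖ τ i).PosSemidef := fun i => (hσ i).1.kronecker (hτ i).1
  refine le_antisymm ?_ (roof_nonneg h _)
  refine (roof_sum_le h _ _ fun i => posSemidef_ofReal_smul (hst i) (hp.1 i)).trans_eq ?_
  refine Finset.sum_eq_zero fun i _ => ?_
  rw [roof_smul h (hp.1 i) (hst i), roof_kronecker h (hσ i).1 (hτ i).1, mul_zero]

end Separable

/-! ### Faithfulness: zero entropy forces a product vector, and the infimum is attained. -/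

section Faithful

lemma eq_zero_or_one_of_rpow_eq_self {x q : ℝ} (hx : 0 ≤ x) (hq : q ≠ 1) (h : x ^ q = x) :
    x = 0 ∨ x = 1 := by
  rcases hx.eq_or_lt with rfl | hx
  · exact Or.inl rfl
  · right
    have h1 := congrArg Real.log h
    rw [Real.log_rpow hx] at h1
    have h2 : (q - 1) * Real.log x = 0 := by linarith
    exact Real.eq_one_of_pos_of_log_eq_zero hx
      ((mul_eq_zero.1 h2).resolve_left (sub_ne_zero.2 hq))

/-- On `[0, 1]` the difference `x ^ q - x` has a constant sign, so equality of the sums forces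
equality for each eigenvalue. Every eigenvalue is thus `0` or `1`, and trace one leaves a single
`1`. -/
lemma exists_eq_ketbra_of_trPow_eq_one {n : Type*} [Fintype n] [DecidableEq n] {q : ℝ}
    (hq : q ≠ 1) {R : Matrix n n ℂ} (hR : IsDensity R) (h : trPow q R = 1) :
    ∃ u : n → ℂ, R = ketbra u := by
  have hA := hR.1.1
  have h0 := hR.1.eigenvalues_nonneg
  have ht := trace_re_eq_sum_eigenvalues hA
  replace ht := (congrArg Complex.re hR.2).symm.trans ht
  rw [Complex.one_re] at ht
  have h1 : ∀ i, hA.eigenvalues i ≤ 1 := fun i => by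
    rw [ht]
    exact Finset.single_le_sum (fun j _ => h0 j) (Finset.mem_univ i)
  rw [trPow_eq_sum_eigenvalues q hA] at h
  have hfix : ∀ i, hA.eigenvalues i ^ q = hA.eigenvalues i := by
    have hsum : ∑ i, hA.eigenvalues i ^ q = ∑ i, hA.eigenvalues i := h.trans ht
    rcases le_total 1 q with hq1 | hq1
    · exact fun i => (Finset.sum_eq_sum_iff_of_le fun i _ =>
        Real.rpow_le_self_of_le_one (h0 i) (h1 i) hq1).1 hsum i (Finset.mem_univ i)
    · exact fun i => ((Finset.sum_eq_sum_iff_of_le fun i _ =>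
        Real.self_le_rpow_of_le_one (h0 i) (h1 i) hq1).1 hsum.symm i (Finset.mem_univ i)).symm
  have h01 := fun i => eq_zero_or_one_of_rpow_eq_self (h0 i) hq (hfix i)
  obtain ⟨j, hj⟩ : ∃ j, hA.eigenvalues j = 1 := by
    by_contra! hne
    have : ∑ i, hA.eigenvalues i = 0 :=
      Finset.sum_eq_zero fun i _ => (h01 i).resolve_right (hne i)
    linarith
  have hother : ∀ i, i ≠ j → hA.eigenvalues i = 0 := by
    have hj' := Finset.add_sum_erase Finset.univ hA.eigenvalues (Finset.mem_univ j)
    rw [← ht, hj, add_eq_left] at hj'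
    intro i hi
    exact (Finset.sum_eq_zero_iff_of_nonneg fun k _ => h0 k).1 hj' i
      (Finset.mem_erase.2 ⟨hi, Finset.mem_univ i⟩)
  refine ⟨fun i => (hA.eigenvectorUnitary : Matrix n n ℂ) i j, ?_⟩
  conv_lhs => rw [hA.spectral_theorem, Unitary.conjStarAlgAut_apply]
  ext i k
  rw [Matrix.mul_apply, Finset.sum_eq_single j]
  · simp [ketbra, vecMulVec_apply, hj]
  · intro l _ hl
    simp [hother l hl]
  · simp

/-- The projection `1 - ketbra u` kills `V * Vᴴ`, hence also `V`, so every column of `V` is a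
multiple of `u`. -/
lemma exists_eq_vecMulVec_of_mul_conjTranspose {m n : Type*} [Fintype m] [DecidableEq m]
    [Fintype n] {V : Matrix m n ℂ} {u : m → ℂ} (hV : V * Vᴴ = ketbra u) (hu : IsUnitVec u) :
    ∃ w : n → ℂ, V = vecMulVec u w := by
  have hu' : star u ⬝ᵥ u = 1 := hu
  have h1 : (1 - ketbra u) * (V * Vᴴ) = 0 := by
    rw [hV, Matrix.sub_mul, Matrix.one_mul, ketbra, vecMulVec_mul_vecMulVec, hu', one_smul,
      sub_self]
  rw [mul_self_mul_conjTranspose_eq_zero, Matrix.sub_mul, Matrix.one_mul, sub_eq_zero] at h1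
  exact ⟨star u ᵥ* V, by rw [← vecMulVec_mul]; exact h1⟩

variable {a b : ℕ}

lemma exists_eq_prodVec_of_pureConcurrence_eq_zero {q s : ℝ} (h : Admissible q s) (hq : q ≠ 1)
    {ψ : Fin a × Fin b → ℂ} (hψ : IsUnitVec ψ) (h0 : pureConcurrence q s ψ = 0) :
    ∃ (u : Fin a → ℂ) (w : Fin b → ℂ), IsUnitVec u ∧ IsUnitVec w ∧ ψ = prodVec u w := by
  have hd : IsDensity (reduceA (ketbra ψ)) :=
    ⟨posSemidef_reduceA_ketbra ψ, by rw [trace_reduceA, trace_ketbra, hψ]⟩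
  have hε : signFactor q s ≠ 0 := by
    rcases h with h | h
    · simp [signFactor_of_regimeOne h]
    · simp [signFactor_of_regimeTwo h]
  have h1 : trPow q (reduceA (ketbra ψ)) ^ s = 1 := by
    have := (mul_eq_zero.1 h0).resolve_left hε
    linarith
  have h2 : trPow q (reduceA (ketbra ψ)) = 1 := by
    rwa [← Real.one_rpow s,
      Real.rpow_left_inj (trPow_nonneg q hd.1) zero_le_one h.s_pos.ne'] at h1
  obtain ⟨u, hu⟩ := exists_eq_ketbra_of_trPow_eq_one hq hd h2
  have hu1 : IsUnitVec u := by
    rw [IsUnitVec, ← trace_ketbra, ← hu, hd.2]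
  obtain ⟨w, hw⟩ := exists_eq_vecMulVec_of_mul_conjTranspose
    ((reduceA_ketbra ψ).symm.trans hu) hu1
  have hprod : ψ = prodVec u w := by
    ext x
    exact congrFun (congrFun hw x.1) x.2
  refine ⟨u, w, hu1, ?_, hprod⟩
  have htr := hd.2
  rw [hprod, reduceA_ketbra_prodVec, trace_smul, trace_ketbra] at htr
  rwa [show star u ⬝ᵥ u = 1 from hu1, smul_eq_mul, mul_one] at htr

/-- By Carathéodory, `finrank + 1` points suffice, so the hull is a continuous image of the compact
set of weights and points. -/
lemma isCompact_convexHull_of_isCompact {E : Type*} [AddCommGroup E] [Module ℝ E]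
    [TopologicalSpace E] [ContinuousAdd E] [ContinuousSMul ℝ E] [FiniteDimensional ℝ E]
    {S : Set E} (hS : IsCompact S) : IsCompact (convexHull ℝ S) := by
  set N := Module.finrank ℝ E + 1
  have himg : convexHull ℝ S = (fun x : (Fin N → ℝ) × (Fin N → E) => ∑ i, x.1 i • x.2 i) ''
      (stdSimplex ℝ (Fin N) ×ˢ Set.pi Set.univ fun _ => S) := by
    apply Set.Subset.antisymm
    · intro x hx
      obtain ⟨ι, _, z, w, hz, hind, hw, hw1, rfl⟩ := eq_pos_convex_span_of_mem_convexHull hx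
      obtain ⟨i₀⟩ : Nonempty ι := by
        by_contra hne
        rw [not_nonempty_iff] at hne
        simp at hw1
      have hcard : Fintype.card ι ≤ Fintype.card (Fin N) := by
        rw [Fintype.card_fin]
        exact hind.card_le_finrank_succ.trans
          (Nat.add_le_add_right (Submodule.finrank_le _) 1)
      obtain ⟨e⟩ := Function.Embedding.nonempty_of_card_le hcard
      -- Unused slots get weight `0` and the dummy point `z i₀`, which lies in `S`.
      refine ⟨(Function.extend e w 0, Function.extend e z fun _ => z i₀), ⟨⟨?_, ?_⟩, ?_⟩, ?_⟩
      · intro j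
        by_cases hj : ∃ i, e i = j
        · obtain ⟨i, rfl⟩ := hj
          simpa [e.injective.extend_apply] using (hw i).le
        · simp [Function.extend_apply' _ _ _ hj]
      · rw [← hw1]
        refine (Fintype.sum_of_injective e e.injective _ _ ?_ ?_).symm
        · intro j hj
          exact Function.extend_apply' _ _ _ hj
        · intro i
          exact (e.injective.extend_apply _ _ i).symm
      · intro j _
        by_cases hj : ∃ i, e i = j
        · obtain ⟨i, rfl⟩ := hj
          simpa [e.injective.extend_apply] using hz ⟨i, rfl⟩
        · simpa [Function.extend_apply' _ _ _ hj] using hz ⟨i₀, rfl⟩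
      · refine (Fintype.sum_of_injective e e.injective _ _ ?_ ?_).symm
        · intro j hj
          simp [Function.extend_apply' w (0 : Fin N → ℝ) j hj]
        · intro i
          simp [e.injective.extend_apply]
    · rintro _ ⟨⟨w, z⟩, ⟨hw, hz⟩, rfl⟩
      exact (convex_convexHull ℝ S).sum_mem (fun i _ => hw.1 i) hw.2
        fun i _ => subset_convexHull ℝ S (hz i trivial)
  rw [himg]
  refine ((isCompact_stdSimplex ℝ (Fin N)).prod (isCompact_univ_pi fun _ => hS)).image ?_
  fun_prop

-- Density matrices have spectrum in the fixed compact set `[0, 1]`, on which the functional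
-- calculus depends continuously on the matrix in the C⋆-norm.
open scoped Matrix.Norms.L2Operator in
lemma continuousOn_trPow {n : Type*} [Fintype n] [DecidableEq n] {q : ℝ} (hq : 0 < q) :
    ContinuousOn (trPow q) {R : Matrix n n ℂ | IsDensity R} := by
  have h : ContinuousOn (fun R : Matrix n n ℂ => cfc (fun x : ℝ => x ^ q) R)
      {R : Matrix n n ℂ | IsDensity R} := by
    refine ContinuousOn.cfc' (isCompact_Icc (a := (0 : ℝ)) (b := 1)) _ continuousOn_id ?_ ?_ ?_
    · intro R hR x hx
      rw [hR.1.1.spectrum_real_eq_range_eigenvalues] at hx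
      obtain ⟨i, rfl⟩ := hx
      have ht := trace_re_eq_sum_eigenvalues hR.1.1
      replace ht := (congrArg Complex.re hR.2).symm.trans ht
      rw [Complex.one_re] at ht
      refine ⟨hR.1.eigenvalues_nonneg i, ?_⟩
      rw [ht]
      exact Finset.single_le_sum (fun j _ => hR.1.eigenvalues_nonneg j) (Finset.mem_univ i)
    · exact fun R hR => hR.1.1
    · exact (Real.continuous_rpow_const hq.le).continuousOn
  exact (Complex.continuous_re.comp (continuous_id.matrix_trace)).comp_continuousOn h

lemma isCompact_setOf_isUnitVec {n : Type*} [Fintype n] :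
    IsCompact {ψ : n → ℂ | IsUnitVec ψ} := by
  refine Metric.isCompact_of_isClosed_isBounded ?_ ?_
  · exact isClosed_eq (by fun_prop) continuous_const
  · refine (Metric.isBounded_closedBall (x := (0 : n → ℂ)) (r := 1)).subset fun ψ hψ => ?_
    rw [mem_closedBall_zero_iff, pi_norm_le_iff_of_nonneg zero_le_one]
    intro i
    have h : ∑ i, ‖ψ i‖ ^ 2 = 1 := by
      have h : star ψ ⬝ᵥ ψ = 1 := hψ
      simp only [dotProduct, Pi.star_apply, RCLike.star_def, Complex.conj_mul'] at h
      exact_mod_cast h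
    have hi : ‖ψ i‖ ^ 2 ≤ 1 := by
      rw [← h]
      exact Finset.single_le_sum (fun j _ => sq_nonneg ‖ψ j‖) (Finset.mem_univ i)
    exact (sq_le_one_iff₀ (norm_nonneg _)).1 hi

lemma continuous_ketbra {n : Type*} : Continuous (ketbra : (n → ℂ) → Matrix n n ℂ) :=
  continuous_id.matrix_vecMulVec continuous_star

lemma continuousOn_pureConcurrence {q s : ℝ} (h : Admissible q s) :
    ContinuousOn (pureConcurrence q s) {ψ : Fin a × Fin b → ℂ | IsUnitVec ψ} := by
  have hred : Continuous fun ψ : Fin a × Fin b → ℂ => reduceA (ketbra ψ) := by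
    refine continuous_matrix fun i j => ?_
    exact continuous_finsetSum Finset.univ fun k _ =>
      continuous_ketbra.matrix_elem (i, k) (j, k)
  have h1 : ContinuousOn (fun ψ : Fin a × Fin b → ℂ => trPow q (reduceA (ketbra ψ)))
      {ψ | IsUnitVec ψ} :=
    (continuousOn_trPow h.q_pos).comp hred.continuousOn fun ψ hψ =>
      ⟨posSemidef_reduceA_ketbra ψ, by rw [trace_reduceA, trace_ketbra, hψ]⟩
  exact continuousOn_const.mul
    (continuousOn_const.sub (h1.rpow_const fun _ _ => Or.inr h.s_pos.le))

/-- The graph of the pure-state concurrence over the pure states. -/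
def pureGraph (a b : ℕ) (q s : ℝ) : Set (BiMatrix a b × ℝ) :=
  (fun ψ => (ketbra ψ, pureConcurrence q s ψ)) '' {ψ | IsUnitVec ψ}

lemma mem_convexHull_pureGraph {q s : ℝ} {ρ : BiMatrix a b} {c : ℝ}
    (hc : c ∈ roofValues q s ρ) : (ρ, c) ∈ convexHull ℝ (pureGraph a b q s) := by
  obtain ⟨n, p, ψ, ⟨hp, hψ, rfl⟩, rfl⟩ := hc
  refine mem_convexHull_of_exists_fintype p (fun i => (ketbra (ψ i), pureConcurrence q s (ψ i)))
    hp.1 hp.2 (fun i => ⟨ψ i, hψ i, rfl⟩) (Prod.ext ?_ ?_)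
  · rw [Prod.fst_sum]
    exact Finset.sum_congr rfl fun i _ => by ext; simp
  · rw [Prod.snd_sum]
    rfl

/-- This says that the infimum is attained: it is a limit of roof values, and the slice of the
closed hull over `ρ` is closed. -/
lemma concurrence_mem_convexHull_pureGraph {q s : ℝ} (h : Admissible q s) {ρ : BiMatrix a b}
    (hρ : IsDensity ρ) : (ρ, concurrence q s ρ) ∈ convexHull ℝ (pureGraph a b q s) := by
  have hcl : IsClosed (convexHull ℝ (pureGraph a b q s)) :=
    (isCompact_convexHull_of_isCompact (isCompact_setOf_isUnitVec.image_of_continuousOn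
      (continuous_ketbra.continuousOn.prodMk (continuousOn_pureConcurrence h)))).isClosed
  have hmem : concurrence q s ρ ∈ closure (roofValues q s ρ) := by
    rw [concurrence, roofValues_eq h.q_pos hρ]
    exact csInf_mem_closure (vecRoofValues_nonempty q s hρ.1) (bddBelow_vecRoofValues h ρ)
  have hpre : IsClosed {c : ℝ | (ρ, c) ∈ convexHull ℝ (pureGraph a b q s)} :=
    hcl.preimage (by fun_prop : Continuous fun c : ℝ => (ρ, c))
  exact hpre.closure_subset_iff.2 (fun c hc => mem_convexHull_pureGraph hc) hmem

lemma isSeparable_of_concurrence_eq_zero {q s : ℝ} (h : Admissible q s) (hq : q ≠ 1)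
    {ρ : BiMatrix a b} (hρ : IsDensity ρ) (h0 : concurrence q s ρ = 0) : IsSeparable ρ := by
  have hmem := concurrence_mem_convexHull_pureGraph h hρ
  rw [h0] at hmem
  obtain ⟨ι, _, z, w, hz, -, hw, hw1, hx⟩ := eq_pos_convex_span_of_mem_convexHull hmem
  choose ψ hψ hzψ using fun i => hz ⟨i, rfl⟩
  have hC : ∑ i, w i * pureConcurrence q s (ψ i) = 0 := by
    have := congrArg Prod.snd hx
    simpa [Prod.snd_sum, ← hzψ] using this
  have hpos : ∀ i, 0 ≤ pureConcurrence q s (ψ i) := fun i => by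
    rw [← vecConcurrence_of_isUnitVec h.q_pos (hψ i)]
    exact vecConcurrence_nonneg h _
  -- A sum of nonnegative terms with strictly positive weights vanishes only if every term does.
  have hzero : ∀ i, pureConcurrence q s (ψ i) = 0 := fun i =>
    (mul_eq_zero.1 ((Finset.sum_eq_zero_iff_of_nonneg fun j _ =>
      mul_nonneg (hw j).le (hpos j)).1 hC i (Finset.mem_univ i))).resolve_left (hw i).ne'
  choose u v hu hv huv using fun i =>
    exists_eq_prodVec_of_pureConcurrence_eq_zero h hq (hψ i) (hzero i)
  have hsum : ρ = ∑ i, (w i : ℂ) • (ketbra (u i) ⊗ₖ ketbra (v i)) := by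
    have := congrArg Prod.fst hx
    rw [Prod.fst_sum] at this
    refine this.symm.trans (Finset.sum_congr rfl fun i _ => ?_)
    rw [← ketbra_prodVec, ← huv, ← hzψ]
    ext
    simp
  let e := (Fintype.equivFin ι).symm
  refine ⟨Fintype.card ι, fun i => w (e i), fun i => ketbra (u (e i)), fun i => ketbra (v (e i)),
    ⟨fun i => (hw _).le, (e.sum_comp w).trans hw1⟩,
    fun i => ⟨posSemidef_ketbra _, (trace_ketbra _).trans (hu _)⟩,
    fun i => ⟨posSemidef_ketbra _, (trace_ketbra _).trans (hv _)⟩, ?_⟩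
  rw [hsum]
  exact (e.sum_comp fun i => (w i : ℂ) • (ketbra (u i) ⊗ₖ ketbra (v i))).symm

end Faithful

end QSConcurrence

end

theorem mainTheorem1 (q s : ℝ)
    (hqs : (1 ≤ q ∧ 1 ≤ q * s) ∨ ((0 < q ∧ q < 1) ∧ (0 < q * s ∧ q * s < 1))) (a b : ℕ) :
    -- the infimum defining the measure is a genuine one
    (∀ ρ : QSConcurrence.BiMatrix a b, QSConcurrence.IsDensity ρ →
      IsGLB (QSConcurrence.roofValues q s ρ) (QSConcurrence.concurrence q s ρ)) ∧
    -- (E1) non-negativity and faithfulness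
    (∀ ρ : QSConcurrence.BiMatrix a b, QSConcurrence.IsDensity ρ →
      0 ≤ QSConcurrence.concurrence q s ρ ∧
      (QSConcurrence.IsSeparable ρ → QSConcurrence.concurrence q s ρ = 0) ∧
      (q ≠ 1 → QSConcurrence.concurrence q s ρ = 0 → QSConcurrence.IsSeparable ρ)) ∧
    -- (E2) monotonicity on average under LOCC
    (∀ (a' b' : ℕ) (ι : Type) [Fintype ι]
      (M : ι → QSConcurrence.BiMatrix a b →ₗ[ℂ] QSConcurrence.BiMatrix a' b'),
      QSConcurrence.IsLOCC M → ∀ ρ : QSConcurrence.BiMatrix a b, QSConcurrence.IsDensity ρ →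
        ∑ i, (M i ρ).trace.re *
            QSConcurrence.concurrence q s (((M i ρ).trace)⁻¹ • M i ρ) ≤
          QSConcurrence.concurrence q s ρ) ∧
    -- (E3) convexity
    (∀ (n : ℕ) (p : Fin n → ℝ) (ρ : Fin n → QSConcurrence.BiMatrix a b),
      QSConcurrence.IsProb p → (∀ i, QSConcurrence.IsDensity (ρ i)) →
        QSConcurrence.concurrence q s (∑ i, (p i : ℂ) • ρ i) ≤
          ∑ i, p i * QSConcurrence.concurrence q s (ρ i)) := by
  have h : QSConcurrence.Admissible q s := hqs
  refine ⟨fun ρ hρ => ?_, fun ρ hρ => ⟨?_, fun hsep => ?_, fun hq h0 => ?_⟩,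
    fun a' b' ι _ M hM ρ hρ => ?_, fun n p ρ hp hρ => ?_⟩
  · rw [QSConcurrence.concurrence, QSConcurrence.roofValues_eq h.q_pos hρ]
    exact isGLB_csInf (QSConcurrence.vecRoofValues_nonempty q s hρ.1)
      (QSConcurrence.bddBelow_vecRoofValues h ρ)
  · rw [QSConcurrence.concurrence_eq_roof h.q_pos hρ]
    exact QSConcurrence.roof_nonneg h ρ
  · rw [QSConcurrence.concurrence_eq_roof h.q_pos hρ]
    exact hsep.roof_eq_zero h
  · exact QSConcurrence.isSeparable_of_concurrence_eq_zero h hq hρ h0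
  · rw [QSConcurrence.concurrence_eq_roof h.q_pos hρ]
    refine le_trans (le_of_eq ?_) (hM.sum_roof_le h hρ.1)
    exact Finset.sum_congr rfl fun i _ =>
      QSConcurrence.trace_mul_concurrence_normalize h (hM.posSemidef i hρ.1)
  · have hpρ := fun i => QSConcurrence.posSemidef_ofReal_smul (hρ i).1 (hp.1 i)
    have hmix : QSConcurrence.IsDensity (∑ i, (p i : ℂ) • ρ i) := by
      refine ⟨Matrix.posSemidef_sum _ fun i _ => hpρ i, ?_⟩
      rw [Matrix.trace_sum]
      simp only [Matrix.trace_smul, (hρ _).2, smul_eq_mul, mul_one]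
      exact_mod_cast hp.2
    rw [QSConcurrence.concurrence_eq_roof h.q_pos hmix]
    refine (QSConcurrence.roof_sum_le h _ _ hpρ).trans_eq ?_
    refine Finset.sum_congr rfl fun i _ => ?_
    rw [QSConcurrence.roof_smul h (hp.1 i) (hρ i).1,
      QSConcurrence.concurrence_eq_roof h.q_pos (hρ i)]
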